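/- Let $A, B$ be positive definite complex $n \times n$ matrices, let $m \ge 1$ be an integer, and for a real number $\nu$ put $r = \min\{\nu, 1-\nu\}$ and $r_0 = \min\{2r, 1-2r\}$. Write $|X| = (X^*X)^{1/2}$ for a complex matrix $X$. If $0 < \nu \le \frac12$, then $$\left(\operatorname{tr}|A^{1-\nu}B^{\nu}|\right)^m + \nu^m\left(\operatorname{tr}A+\operatorname{tr}B\right)^m - \left(2\nu(\operatorname{tr}A\,\operatorname{tr}B)^{\frac12} - r_0\left((\operatorname{tr}A\,\operatorname{tr}B)^{\frac14} - (\operatorname{tr}A)^{\frac12}\right)^2\right)^m \le \left(\operatorname{tr}((1-\nu)A+\nu B)\right)^m.$$ If $\frac12 \le \nu \le 1$, then $$\left(\operatorname{tr}|A^{1-\nu}B^{\nu}|\right)^m + (1-\nu)^m\left(\operatorname{tr}A+\operatorname{tr}B\right)^m - \left(2(1-\nu)(\operatorname{tr}A\,\operatorname{tr}B)^{\frac12} - r_0\left((\operatorname{tr}A\,\operatorname{tr}B)^{\frac14} - (\operatorname{tr}B)^{\frac12}\right)^2\right)^m \le \left(\operatorname{tr}((1-\nu)A+\nu B)\right)^m.$$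 -/

import Mathlib

open scoped MatrixOrder ComplexOrder

/-- The (real) trace of a complex matrix; it is only applied to Hermitian matrices,
whose trace is real. -/
noncomputable def trR {n : ℕ} (M : Matrix (Fin n) (Fin n) ℂ) : ℝ := M.trace.re

/-- `r₀ = min {2r, 1 - 2r}` with `r = min {ν, 1 - ν}`. -/
noncomputable def rZero (ν : ℝ) : ℝ := min (2 * min ν (1 - ν)) (1 - 2 * min ν (1 - ν))

/-!
Write `a = tr A` and `b = tr B`. Since `(1 - ν) a + ν b - ν (√a - √b)² = (1 - 2ν) a + 2ν √(ab)`,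
Young's inequality for `a`, `√(ab)` and the weight `2ν` refines that for `a`, `b` and `ν`; a second
round gives the remainder with `r₀`. Suppose `0 ≤ x ≤ a ^ (1 - ν) b ^ ν` and put `y = ν (a + b)`,
`w = (1 - ν) a + ν b` and `z = 2ν √(ab) - r₀ (⁴√(ab) - √a)²`. Then `x + y - z ≤ w`, and since
`y ≤ w` and `z ≤ y` this persists for `m`-th powers, even though `z` may be negative.

This applies to `x = tr |A ^ (1 - ν) B ^ ν|`: polar decomposition `|X| = U X` and the spectral
theorem express it as a sum of `α i ^ (1 - ν) * β j ^ ν` over the eigenvalues, with coefficients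
that are products of entries of two unitary matrices. They are dominated by a doubly stochastic
matrix, so Hölder's inequality bounds the sum by `a ^ (1 - ν) b ^ ν`.
-/

theorem pow_add_pow_sub_pow_le {R : Type*} [CommRing R] [LinearOrder R] [IsStrictOrderedRing R]
    {x y z w : R} (hx : 0 ≤ x) (hy : 0 ≤ y) (hyw : y ≤ w) (hzy : z ≤ y) (h : x + y - z ≤ w)
    (m : ℕ) : x ^ m + y ^ m - z ^ m ≤ w ^ m := by
  rcases lt_or_ge z 0 with hz | hz
  · rcases eq_or_ne m 0 with rfl | hm
    · simp
    calc x ^ m + y ^ m - z ^ m ≤ x ^ m + y ^ m + |z| ^ m := by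
          linarith [neg_abs_le (z ^ m), abs_pow z m]
      _ ≤ (x + y + |z|) ^ m :=
          (add_le_add_left (pow_add_pow_le hx hy hm) _).trans
            (pow_add_pow_le (add_nonneg hx hy) (abs_nonneg z) hm)
      _ ≤ w ^ m := by
          rw [abs_of_neg hz]
          exact pow_le_pow_left₀ (by linarith) (by linarith) m
  rcases le_total x z with hxz | hzx
  · linarith [pow_le_pow_left₀ hx hxz m, pow_le_pow_left₀ hy hyw m]
  have hxw : x ≤ w := by linarith
  have hgeom : (∑ i ∈ Finset.range m, x ^ i * z ^ (m - 1 - i)) * (x - z) ≤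
      (∑ i ∈ Finset.range m, w ^ i * y ^ (m - 1 - i)) * (w - y) := by
    have hw : 0 ≤ w := hx.trans hxw
    have : 0 ≤ x - z := sub_nonneg.2 hzx
    have hdiff : x - z ≤ w - y := by linarith
    gcongr
  rw [(Commute.all x z).geom_sum₂_mul, (Commute.all w y).geom_sum₂_mul] at hgeom
  linarith

section Young

variable {a b ν : ℝ}

theorem rpow_mul_rpow_sqrt_mul (ha : 0 ≤ a) (hb : 0 ≤ b) (hν : 0 ≤ ν) (hν' : ν ≤ 1 / 2) :
    a ^ (1 - 2 * ν) * √(a * b) ^ (2 * ν) = a ^ (1 - ν) * b ^ ν := by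
  have hsqrt : √(a * b) ^ (2 * ν) = a ^ ν * b ^ ν := by
    rw [Real.rpow_mul (Real.sqrt_nonneg _), Real.rpow_two, Real.sq_sqrt (mul_nonneg ha hb),
      Real.mul_rpow ha hb]
  rw [hsqrt, ← mul_assoc, ← Real.rpow_add_of_nonneg ha (by linarith) hν]
  ring_nf

theorem arith_mean_eq_add_mul_sq_sqrt_sub_sqrt (ha : 0 ≤ a) (hb : 0 ≤ b) (ν : ℝ) :
    (1 - ν) * a + ν * b = (1 - 2 * ν) * a + 2 * ν * √(a * b) + ν * (√a - √b) ^ 2 := by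
  rw [Real.sqrt_mul ha]
  linear_combination -ν * Real.sq_sqrt ha - ν * Real.sq_sqrt hb

theorem geom_mean_add_min_mul_sq_le_arith_mean (ha : 0 ≤ a) (hb : 0 ≤ b) (hν : 0 ≤ ν)
    (hν' : ν ≤ 1) :
    a ^ (1 - ν) * b ^ ν + min ν (1 - ν) * (√a - √b) ^ 2 ≤ (1 - ν) * a + ν * b := by
  wlog hhalf : ν ≤ 1 / 2 generalizing a b ν
  · have hswap := this hb ha (ν := 1 - ν) (by linarith) (by linarith) (by linarith)
    rw [sub_sub_cancel, min_comm] at hswap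
    linarith [mul_comm (a ^ (1 - ν)) (b ^ ν), congrArg (min ν (1 - ν) * ·) (sub_sq_comm √a √b)]
  have hyoung := Real.geom_mean_le_arith_mean2_weighted (by linarith : 0 ≤ 1 - 2 * ν)
    (by linarith : 0 ≤ 2 * ν) ha (Real.sqrt_nonneg (a * b)) (by ring)
  rw [rpow_mul_rpow_sqrt_mul ha hb hν hhalf] at hyoung
  rw [min_eq_left (by linarith), arith_mean_eq_add_mul_sq_sqrt_sub_sqrt ha hb]
  linarith

theorem geom_mean_add_mul_sq_add_min_mul_sq_le_arith_mean (ha : 0 ≤ a) (hb : 0 ≤ b)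
    (hν : 0 ≤ ν) (hν' : ν ≤ 1 / 2) :
    a ^ (1 - ν) * b ^ ν + ν * (√a - √b) ^ 2 +
        min (2 * ν) (1 - 2 * ν) * (√a - √√(a * b)) ^ 2 ≤ (1 - ν) * a + ν * b := by
  have hrefined := geom_mean_add_min_mul_sq_le_arith_mean ha (Real.sqrt_nonneg (a * b))
    (by linarith : 0 ≤ 2 * ν) (by linarith)
  rw [rpow_mul_rpow_sqrt_mul ha hb hν hν'] at hrefined
  rw [arith_mean_eq_add_mul_sq_sqrt_sub_sqrt ha hb]
  linarith

theorem rZero_of_le_half (hν : ν ≤ 1 / 2) : rZero ν = min (2 * ν) (1 - 2 * ν) := by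
  rw [rZero, min_eq_left (by linarith : ν ≤ 1 - ν)]

theorem rZero_one_sub (ν : ℝ) : rZero (1 - ν) = rZero ν := by
  rw [rZero, rZero, sub_sub_cancel, min_comm (1 - ν)]

theorem rpow_one_div_four_eq_sqrt_sqrt (ha : 0 ≤ a) : a ^ (1 / 4 : ℝ) = √√a := by
  rw [Real.sqrt_eq_rpow, Real.sqrt_eq_rpow, ← Real.rpow_mul ha]
  norm_num

theorem pow_refined_young_le {t : ℝ} (ha : 0 ≤ a) (hb : 0 ≤ b) (hν : 0 ≤ ν) (hν' : ν ≤ 1 / 2)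
    (ht : 0 ≤ t) (htab : t ≤ a ^ (1 - ν) * b ^ ν) (m : ℕ) :
    t ^ m + ν ^ m * (a + b) ^ m
        - (2 * ν * (a * b) ^ (1 / 2 : ℝ)
            - rZero ν * ((a * b) ^ (1 / 4 : ℝ) - a ^ (1 / 2 : ℝ)) ^ 2) ^ m
      ≤ ((1 - ν) * a + ν * b) ^ m := by
  rw [rpow_one_div_four_eq_sqrt_sqrt (mul_nonneg ha hb), ← Real.sqrt_eq_rpow,
    ← Real.sqrt_eq_rpow, sub_sq_comm, rZero_of_le_half hν', ← mul_pow]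
  have hremainder : 0 ≤ min (2 * ν) (1 - 2 * ν) * (√a - √√(a * b)) ^ 2 :=
    mul_nonneg (le_min (by linarith) (by linarith)) (sq_nonneg _)
  have hsq : 0 ≤ ν * (√a - √b) ^ 2 := mul_nonneg hν (sq_nonneg _)
  have hmean := arith_mean_eq_add_mul_sq_sqrt_sub_sqrt ha hb ν
  have hyoung := geom_mean_add_mul_sq_add_min_mul_sq_le_arith_mean ha hb hν hν'
  refine pow_add_pow_sub_pow_le ht (by positivity) ?_ ?_ ?_ m
  · linarith [mul_nonneg (by linarith : 0 ≤ 1 - 2 * ν) ha]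
  · linarith
  · linarith

end Young

theorem sum_rpow_mul_rpow_le_of_nonneg {ι : Type*} (s : Finset ι) {f g : ι → ℝ}
    (hf : ∀ i ∈ s, 0 ≤ f i) (hg : ∀ i ∈ s, 0 ≤ g i) {ν : ℝ} (hν : 0 ≤ ν) (hν' : ν ≤ 1) :
    ∑ i ∈ s, f i ^ (1 - ν) * g i ^ ν ≤ (∑ i ∈ s, f i) ^ (1 - ν) * (∑ i ∈ s, g i) ^ ν := by
  rcases hν.eq_or_lt with rfl | hpos
  · simp
  rcases hν'.eq_or_lt with rfl | hlt
  · simp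
  have hconj : (1 - ν)⁻¹.HolderConjugate ν⁻¹ :=
    Real.HolderConjugate.inv_inv (by linarith) hpos (by ring)
  have hholder := Real.inner_le_Lp_mul_Lq_of_nonneg s hconj
    (fun i hi => Real.rpow_nonneg (hf i hi) (1 - ν)) (fun i hi => Real.rpow_nonneg (hg i hi) ν)
  rw [one_div, one_div, inv_inv, inv_inv] at hholder
  refine hholder.trans_eq ?_
  congr 2
  · exact Finset.sum_congr rfl fun i hi => Real.rpow_rpow_inv (hf i hi) (by linarith)
  · exact Finset.sum_congr rfl fun i hi => Real.rpow_rpow_inv (hg i hi) hpos.ne'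

section PolarDecomposition

open Matrix

theorem exists_linearIsometry_comp_eq {𝕜 V E : Type*} [RCLike 𝕜] [AddCommGroup V] [Module 𝕜 V]
    [NormedAddCommGroup E] [InnerProductSpace 𝕜 E] [FiniteDimensional 𝕜 E] {S T : V →ₗ[𝕜] E}
    (h : ∀ v, ‖S v‖ = ‖T v‖) : ∃ U : E →ₗᵢ[𝕜] E, U.toLinearMap ∘ₗ S = T := by
  obtain ⟨σ, hσ⟩ := S.rangeRestrict.exists_rightInverse_of_surjective S.range_rangeRestrict
  have hSσ : ∀ y : S.range, S (σ y) = y := fun y => congrArg Subtype.val (LinearMap.congr_fun hσ y)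
  let L : S.range →ₗᵢ[𝕜] E := ⟨T ∘ₗ σ, fun y => by simp [← h, hSσ]⟩
  refine ⟨L.extend, LinearMap.ext fun v => ?_⟩
  have hL : L.extend (S v) = T (σ (S.rangeRestrict v)) := L.extend_apply (S.rangeRestrict v)
  have hT : T (σ (S.rangeRestrict v) - v) = 0 := by
    rw [← norm_eq_zero, ← h, map_sub, hSσ]
    simp
  rw [map_sub, sub_eq_zero] at hT
  exact hL.trans hT

variable {𝕜 n : Type*} [RCLike 𝕜] [Fintype n] [DecidableEq n]

theorem norm_toEuclideanLin_eq_of_star_mul_self_eq {X Y : Matrix n n 𝕜}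
    (h : star X * X = star Y * Y) (v : EuclideanSpace 𝕜 n) :
    ‖toEuclideanLin X v‖ = ‖toEuclideanLin Y v‖ := by
  have hsq : ∀ Z : Matrix n n 𝕜, ‖toEuclideanLin Z v‖ ^ 2 =
      RCLike.re (inner 𝕜 (toEuclideanLin (star Z * Z) v) v) := fun Z => by
    simpa [← coe_toEuclideanCLM_eq_toEuclideanLin, map_star, ContinuousLinearMap.star_eq_adjoint]
      using (toEuclideanCLM (𝕜 := 𝕜) Z).apply_norm_sq_eq_inner_adjoint_left v
  rw [← sq_eq_sq₀ (norm_nonneg _) (norm_nonneg _), hsq, hsq, h]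

theorem exists_unitary_mul_eq_of_star_mul_self_eq {X Y : Matrix n n 𝕜}
    (h : star X * X = star Y * Y) : ∃ U ∈ unitaryGroup n 𝕜, U * X = Y := by
  obtain ⟨U, hU⟩ := exists_linearIsometry_comp_eq (norm_toEuclideanLin_eq_of_star_mul_self_eq h)
  refine ⟨toEuclideanLin.symm U.toLinearMap, ?_, ?_⟩
  · exact (U.toLinearIsometryEquiv rfl).toMatrix_mem_unitaryGroup (EuclideanSpace.basisFun n 𝕜)
      (EuclideanSpace.basisFun n 𝕜)
  · apply toEuclideanLin.injective
    rw [toLpLin_mul_same, LinearEquiv.apply_symm_apply, hU]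

theorem exists_unitary_mul_eq_abs (X : Matrix n n 𝕜) :
    ∃ U ∈ unitaryGroup n 𝕜, U * X = CFC.abs X := by
  refine exists_unitary_mul_eq_of_star_mul_self_eq ?_
  rw [(CFC.abs_nonneg X).isSelfAdjoint.star_eq, CFC.abs_mul_abs]

end PolarDecomposition

section TraceHolder

open Matrix

variable {𝕜 n : Type*} [RCLike 𝕜] [Fintype n] [DecidableEq n]

theorem map_norm_sq_mem_doublyStochastic {U : Matrix n n 𝕜} (hU : U ∈ unitaryGroup n 𝕜) :
    U.map (‖·‖ ^ 2) ∈ doublyStochastic ℝ n := by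
  have hrow : ∀ {V : Matrix n n 𝕜}, V ∈ unitaryGroup n 𝕜 → ∀ i, ∑ j, ‖V i j‖ ^ 2 = 1 := by
    intro V hV i
    have hdiag := congrFun₂ (mem_unitaryGroup_iff.1 hV) i i
    simp only [mul_apply, star_apply, one_apply_eq, RCLike.star_def, RCLike.mul_conj] at hdiag
    exact_mod_cast hdiag
  refine mem_doublyStochastic_iff_sum.2 ⟨fun i j => sq_nonneg _, hrow hU, fun j => ?_⟩
  simpa using hrow (Unitary.star_mem hU) j

theorem trace_mul_diagonal_mul_mul_diagonal {R : Type*} [CommSemiring R] (P Q : Matrix n n R)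
    (x y : n → R) : (P * diagonal x * (Q * diagonal y)).trace =
      ∑ i, ∑ j, P j i * Q i j * (x i * y j) := by
  rw [trace, Finset.sum_comm]
  simp only [diag_apply, mul_apply (M := P * _), mul_diagonal]
  exact Finset.sum_congr rfl fun j _ => Finset.sum_congr rfl fun i _ => by ring

theorem exists_doublyStochastic_re_trace_diagonal_le {P Q : Matrix n n 𝕜}
    (hP : P ∈ unitaryGroup n 𝕜) (hQ : Q ∈ unitaryGroup n 𝕜) :
    ∃ S ∈ doublyStochastic ℝ n, ∀ x y : n → ℝ, 0 ≤ x → 0 ≤ y →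
      RCLike.re (P * diagonal (RCLike.ofReal ∘ x) * (Q * diagonal (RCLike.ofReal ∘ y))).trace ≤
        ∑ i, ∑ j, S i j * (x i * y j) := by
  refine ⟨(2⁻¹ : ℝ) • (P.map (‖·‖ ^ 2))ᵀ + (2⁻¹ : ℝ) • Q.map (‖·‖ ^ 2),
    convex_doublyStochastic
      (transpose_mem_doublyStochastic_iff.2 (map_norm_sq_mem_doublyStochastic hP))
      (map_norm_sq_mem_doublyStochastic hQ) (by norm_num) (by norm_num) (by norm_num),
    fun x y hx hy => ?_⟩
  rw [trace_mul_diagonal_mul_mul_diagonal]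
  simp only [map_sum, Function.comp_apply, ← RCLike.ofReal_mul, RCLike.re_mul_ofReal]
  refine Finset.sum_le_sum fun i _ => Finset.sum_le_sum fun j _ =>
    mul_le_mul_of_nonneg_right ?_ (mul_nonneg (hx i) (hy j))
  calc RCLike.re (P j i * Q i j) ≤ ‖P j i‖ * ‖Q i j‖ :=
        (RCLike.re_le_norm _).trans_eq (norm_mul _ _)
    _ ≤ 2⁻¹ * ‖P j i‖ ^ 2 + 2⁻¹ * ‖Q i j‖ ^ 2 := by linarith [two_mul_le_add_sq ‖P j i‖ ‖Q i j‖]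

theorem sum_doublyStochastic_mul_rpow_mul_rpow_le {S : Matrix n n ℝ}
    (hS : S ∈ doublyStochastic ℝ n) {x y : n → ℝ} (hx : 0 ≤ x) (hy : 0 ≤ y) {ν : ℝ}
    (hν : 0 ≤ ν) (hν' : ν ≤ 1) :
    ∑ i, ∑ j, S i j * (x i ^ (1 - ν) * y j ^ ν) ≤ (∑ i, x i) ^ (1 - ν) * (∑ j, y j) ^ ν := by
  have hS₀ : ∀ i j, 0 ≤ S i j := fun i j => nonneg_of_mem_doublyStochastic hS
  have hsplit : ∀ i j, S i j * (x i ^ (1 - ν) * y j ^ ν) =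
      (S i j * x i) ^ (1 - ν) * (S i j * y j) ^ ν := fun i j => by
    rw [Real.mul_rpow (hS₀ i j) (hx i), Real.mul_rpow (hS₀ i j) (hy j), mul_mul_mul_comm,
      ← Real.rpow_add_of_nonneg (hS₀ i j) (by linarith) hν, sub_add_cancel, Real.rpow_one]
  have hrow : ∑ i, ∑ j, S i j * x i = ∑ i, x i := by
    simp only [← Finset.sum_mul, sum_row_of_mem_doublyStochastic hS, one_mul]
  have hcol : ∑ i, ∑ j, S i j * y j = ∑ j, y j := by
    rw [Finset.sum_comm]
    simp only [← Finset.sum_mul, sum_col_of_mem_doublyStochastic hS, one_mul]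
  simp only [hsplit, ← hrow, ← hcol, ← Fintype.sum_prod_type']
  exact sum_rpow_mul_rpow_le_of_nonneg _ (fun p _ => mul_nonneg (hS₀ _ _) (hx _))
    (fun p _ => mul_nonneg (hS₀ _ _) (hy _)) hν hν'

theorem rpow_eq_eigenvectorUnitary_mul_diagonal_mul_star {A : Matrix n n 𝕜}
    (hA : A.PosSemidef) (s : ℝ) :
    A ^ s = (hA.1.eigenvectorUnitary : Matrix n n 𝕜) *
      diagonal (RCLike.ofReal ∘ (hA.1.eigenvalues · ^ s)) *
      star (hA.1.eigenvectorUnitary : Matrix n n 𝕜) := by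
  rw [CFC.rpow_eq_cfc_real hA.nonneg, hA.1.cfc_eq]
  rfl

theorem re_trace_eq_sum_eigenvalues {A : Matrix n n 𝕜} (hA : A.IsHermitian) :
    RCLike.re A.trace = ∑ i, hA.eigenvalues i := by
  rw [hA.trace_eq_sum_eigenvalues, ← RCLike.ofReal_sum, RCLike.ofReal_re]

theorem re_trace_unitary_mul_rpow_mul_rpow_le {A B U : Matrix n n 𝕜} (hA : A.PosSemidef)
    (hB : B.PosSemidef) (hU : U ∈ unitaryGroup n 𝕜) {ν : ℝ} (hν : 0 ≤ ν) (hν' : ν ≤ 1) :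
    RCLike.re (U * (A ^ (1 - ν) * B ^ ν)).trace ≤
      RCLike.re A.trace ^ (1 - ν) * RCLike.re B.trace ^ ν := by
  set V := (hA.1.eigenvectorUnitary : Matrix n n 𝕜)
  set W := (hB.1.eigenvectorUnitary : Matrix n n 𝕜)
  have hVmem : V ∈ unitaryGroup n 𝕜 := hA.1.eigenvectorUnitary.2
  have hWmem : W ∈ unitaryGroup n 𝕜 := hB.1.eigenvectorUnitary.2
  set α := hA.1.eigenvalues
  set β := hB.1.eigenvalues
  have hApow : A ^ (1 - ν) = V * diagonal (RCLike.ofReal ∘ (α · ^ (1 - ν))) * star V :=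
    rpow_eq_eigenvectorUnitary_mul_diagonal_mul_star hA _
  have hBpow : B ^ ν = W * diagonal (RCLike.ofReal ∘ (β · ^ ν)) * star W :=
    rpow_eq_eigenvectorUnitary_mul_diagonal_mul_star hB _
  have hα : 0 ≤ α := hA.eigenvalues_nonneg
  have hβ : 0 ≤ β := hB.eigenvalues_nonneg
  obtain ⟨S, hS, htrace⟩ := exists_doublyStochastic_re_trace_diagonal_le
    (mul_mem (mul_mem (Unitary.star_mem hWmem) hU) hVmem)
    (mul_mem (Unitary.star_mem hVmem) hWmem)
  have hcycle : (U * (A ^ (1 - ν) * B ^ ν)).trace =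
      (star W * U * V * diagonal (RCLike.ofReal ∘ (α · ^ (1 - ν))) *
        (star V * W * diagonal (RCLike.ofReal ∘ (β · ^ ν)))).trace := by
    rw [hApow, hBpow]
    simp only [← Matrix.mul_assoc]
    rw [trace_mul_comm]
    simp only [Matrix.mul_assoc]
  rw [hcycle, re_trace_eq_sum_eigenvalues hA.1, re_trace_eq_sum_eigenvalues hB.1]
  exact (htrace _ _ (fun i => Real.rpow_nonneg (hα i) _) fun j => Real.rpow_nonneg (hβ j) _).trans
    (sum_doublyStochastic_mul_rpow_mul_rpow_le hS hα hβ hν hν')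

theorem re_trace_abs_rpow_mul_rpow_le {A B : Matrix n n 𝕜} (hA : A.PosSemidef)
    (hB : B.PosSemidef) {ν : ℝ} (hν : 0 ≤ ν) (hν' : ν ≤ 1) :
    RCLike.re (CFC.abs (A ^ (1 - ν) * B ^ ν)).trace ≤
      RCLike.re A.trace ^ (1 - ν) * RCLike.re B.trace ^ ν := by
  obtain ⟨U, hU, hUX⟩ := exists_unitary_mul_eq_abs (A ^ (1 - ν) * B ^ ν)
  rw [← hUX]
  exact re_trace_unitary_mul_rpow_mul_rpow_le hA hB hU hν hν'

theorem theorem3p4_general {A B : Matrix n n 𝕜} (hA : A.PosSemidef) (hB : B.PosSemidef) (ν : ℝ)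
    (m : ℕ) :
    (0 ≤ ν → ν ≤ 1 / 2 →
      RCLike.re (CFC.abs (A ^ (1 - ν) * B ^ ν)).trace ^ m
        + ν ^ m * (RCLike.re A.trace + RCLike.re B.trace) ^ m
        - (2 * ν * (RCLike.re A.trace * RCLike.re B.trace) ^ (1 / 2 : ℝ)
            - rZero ν * ((RCLike.re A.trace * RCLike.re B.trace) ^ (1 / 4 : ℝ)
              - RCLike.re A.trace ^ (1 / 2 : ℝ)) ^ 2) ^ m
        ≤ RCLike.re ((1 - ν) • A + ν • B).trace ^ m) ∧
    (1 / 2 ≤ ν → ν ≤ 1 →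
      RCLike.re (CFC.abs (A ^ (1 - ν) * B ^ ν)).trace ^ m
        + (1 - ν) ^ m * (RCLike.re A.trace + RCLike.re B.trace) ^ m
        - (2 * (1 - ν) * (RCLike.re A.trace * RCLike.re B.trace) ^ (1 / 2 : ℝ)
            - rZero ν * ((RCLike.re A.trace * RCLike.re B.trace) ^ (1 / 4 : ℝ)
              - RCLike.re B.trace ^ (1 / 2 : ℝ)) ^ 2) ^ m
        ≤ RCLike.re ((1 - ν) • A + ν • B).trace ^ m) := by
  have hre : ∀ {M : Matrix n n 𝕜}, M.PosSemidef → 0 ≤ RCLike.re M.trace := fun hM =>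
    (RCLike.nonneg_iff.1 hM.trace_nonneg).1
  have ha := hre hA
  have hb := hre hB
  have ht := hre (nonneg_iff_posSemidef.1 (CFC.abs_nonneg (A ^ (1 - ν) * B ^ ν)))
  have hmean : RCLike.re ((1 - ν) • A + ν • B).trace =
      (1 - ν) * RCLike.re A.trace + ν * RCLike.re B.trace := by
    simp only [trace_add, trace_smul, map_add, RCLike.smul_re]
  rw [hmean]
  refine ⟨fun h₀ h₁ => ?_, fun h₀ h₁ => ?_⟩
  · exact pow_refined_young_le ha hb h₀ h₁ ht
      (re_trace_abs_rpow_mul_rpow_le hA hB h₀ (by linarith)) m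
  · have hholder := re_trace_abs_rpow_mul_rpow_le hA hB (by linarith) h₁
    have hyoung := pow_refined_young_le hb ha (ν := 1 - ν) (by linarith) (by linarith) ht
      (by rwa [sub_sub_cancel, mul_comm]) m
    rwa [sub_sub_cancel, rZero_one_sub, mul_comm (RCLike.re B.trace), add_comm (RCLike.re B.trace),
      add_comm (ν * _)] at hyoung

end TraceHolder

theorem theorem3p4 {n : ℕ} (A B : Matrix (Fin n) (Fin n) ℂ) (hA : A.PosDef) (hB : B.PosDef)
    (ν : ℝ) (m : ℕ) (hm : 1 ≤ m) :
    (0 < ν → ν ≤ 1 / 2 →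
      trR (CFC.abs (A ^ (1 - ν) * B ^ ν)) ^ m + ν ^ m * (trR A + trR B) ^ m
        - (2 * ν * (trR A * trR B) ^ (1 / 2 : ℝ)
            - rZero ν * ((trR A * trR B) ^ (1 / 4 : ℝ) - trR A ^ (1 / 2 : ℝ)) ^ 2) ^ m
        ≤ trR ((1 - ν) • A + ν • B) ^ m) ∧
    (1 / 2 ≤ ν → ν ≤ 1 →
      trR (CFC.abs (A ^ (1 - ν) * B ^ ν)) ^ m + (1 - ν) ^ m * (trR A + trR B) ^ m
        - (2 * (1 - ν) * (trR A * trR B) ^ (1 / 2 : ℝ)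
            - rZero ν * ((trR A * trR B) ^ (1 / 4 : ℝ) - trR B ^ (1 / 2 : ℝ)) ^ 2) ^ m
        ≤ trR ((1 - ν) • A + ν • B) ^ m) :=
  (theorem3p4_general hA.posSemidef hB.posSemidef ν m).imp_left fun h h₀ => h h₀.le
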